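/- **Setting.** Let $X$, $U$, $U_d$ be complex Hilbert spaces, $\kappa\ge 0$, and let $S=\begin{pmatrix}A\&B\\ C\&D\end{pmatrix}:D(S)\subset X\times(U\times U_d)\to X\times U$ be a well-posed system node. That is, $S$ is closed; $Ax=A\&B(x,0,0)$, $D(A)=\{x\in X : (x,0,0)\in D(S)\}$, generates a strongly continuous semigroup on $X$; $A\&B$ extends to a bounded operator $[A,B]: X\times (U\times U_d)\to X_{-1}$ with $D(S)=\{(x,u,w) : Ax+B(u,w)\in X\}$, where $X_{-1}$ is the completion of $X$ in the norm $\|(\lambda_0-A)^{-1}\cdot\|$ for a fixed $\lambda_0\in\rho(A)$; and for every $\tau>0$ there is $K$ such that $\|x(\tau)\|^2+\int_0^\tau\|y\|^2\le K\left(\|x(0)\|^2+\int_0^\tau\|(u,w)\|^2\right)$ for all $x\in C^1([0,\infty);X)$ and continuous $u,w,y$ with $(\dot x,y)=S(x,u,w)$ on $[0,\infty)$. The transfer function of $S$ is $P(\lambda)=[P_c(\lambda),P_d(\lambda)]$, $P(\lambda)(u,w)=C\&D\left((\lambda-A)^{-1}B(u,w),u,w\right)$, $\lambda\in\rho(A)$.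 Assume the impedance passivity inequality $$\operatorname{Re}\langle A\&B(x,u,0),x\rangle_X\le \operatorname{Re}\langle C\&D(x,u,0),u\rangle_U\qquad\text{for all }(x,u,0)\in D(S),$$ and that $\operatorname{Re}P_c(\lambda)\ge c\,I$ for some $\lambda\in\rho(A)\cap(0,\infty)$ and $c>0$, where $\operatorname{Re}T=\frac12(T+T^*)$. Let $S^\kappa$ be the closed-loop system node of $S$ under the output feedback $u=-\kappa y+\tilde u$: $S^\kappa(x,\tilde u,w)=(z,y)$ if and only if $(x,\tilde u-\kappa y,w)\in D(S)$ and $S(x,\tilde u-\kappa y,w)=(z,y)$. Let $A^\kappa$, $B^\kappa=[B_c^\kappa,B_d^\kappa]$ and $P^\kappa=[P_c^\kappa,P_d^\kappa]$ be the operators $A,B$ and the transfer function associated as above with $S^\kappa$ in place of $S$; thus $D(A^\kappa)=\{x : \exists v\in U,\ (x,-\kappa v,0)\in D(S),\ v=C\&D(x,-\kappa v,0)\}$ and $A^\kappa x=A\&B(x,-\kappa v,0)$. **Proposition.** Let $A_{\mathrm{exo}}\in\mathbb C^{q'\times q'}$ be skew-Hermitian with $\sigma(A_{\mathrm{exo}})\cap\sigma(A^\kappa)=\varnothing$,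 suppose that $P_c^\kappa(\lambda)$ is boundedly invertible for every $\lambda\in\sigma(A_{\mathrm{exo}})$, and let $E\in\mathcal L(\mathbb C^{q'},U_d)$ and $F\in\mathcal L(\mathbb C^{q'},U)$. Then there is a unique $(\Pi,\Gamma)\in\mathcal L(\mathbb C^{q'},X\times U)$ such that $(\Pi v,\Gamma v,Ev)\in D(S)$ for all $v\in\mathbb C^{q'}$ and $$\begin{pmatrix}\Pi A_{\mathrm{exo}}\\ F\end{pmatrix}=S\begin{pmatrix}\Pi\\ \Gamma\\ E\end{pmatrix}.$$ Moreover, if $\varphi_1,\dots,\varphi_{q'}$ are linearly independent with $A_{\mathrm{exo}}\varphi_k=\lambda_k\varphi_k$, then $(\Pi,\Gamma)\in\mathcal L(\mathbb C^{q'},X\times U)$ is this solution if and only if, for every $k\in\{1,\dots,q'\}$, $$\Pi\varphi_k=(\lambda_k-A^\kappa)^{-1}B_c^\kappa(\Gamma\varphi_k+\kappa F\varphi_k)+(\lambda_k-A^\kappa)^{-1}B_d^\kappa E\varphi_k,$$ $$\Gamma\varphi_k=P_c^\kappa(\lambda_k)^{-1}\left((I-\kappa P_c^\kappa(\lambda_k))F\varphi_k-P_d^\kappa(\lambda_k)E\varphi_k\right).$$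 -/

import Mathlib

open Filter Topology MeasureTheory
open scoped InnerProductSpace

noncomputable section

namespace SysNode

/-! ### Unbounded operators: resolvent, semigroup generation, extrapolation space -/

section Operators

variable {X : Type*} [NormedAddCommGroup X] [NormedSpace ℂ X]

/-- `R = (lam - A)⁻¹`: a bounded operator with range in `D(A)` that is a two-sided inverse of
`lam - A : D(A) → X`. -/
def IsResolventAt (A : X →ₗ.[ℂ] X) (lam : ℂ) (R : X →L[ℂ] X) : Prop :=
  (∀ y : X, ∃ h : R y ∈ A.domain, lam • R y - A ⟨R y, h⟩ = y) ∧
    ∀ x : A.domain, R (lam • (x : X) - A x) = x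

/-- The resolvent set `ρ(A)` of an unbounded operator. -/
def resolventSet (A : X →ₗ.[ℂ] X) : Set ℂ := {lam | ∃ R : X →L[ℂ] X, IsResolventAt A lam R}

/-- The spectrum `σ(A) = ℂ \ ρ(A)` of an unbounded operator. -/
def opSpectrum (A : X →ₗ.[ℂ] X) : Set ℂ := (resolventSet A)ᶜ

open Classical in
/-- The resolvent operator `(lam - A)⁻¹` for `lam ∈ ρ(A)` (and `0` otherwise). -/
def resolvent (A : X →ₗ.[ℂ] X) (lam : ℂ) : X →L[ℂ] X :=
  if h : ∃ R : X →L[ℂ] X, IsResolventAt A lam R then h.choose else 0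

/-- `A` is the generator of a strongly continuous semigroup `T` on `X`. -/
def GeneratesC0Semigroup (A : X →ₗ.[ℂ] X) : Prop :=
  ∃ T : NNReal → X →L[ℂ] X,
    T 0 = ContinuousLinearMap.id ℂ X ∧
    (∀ s t, T (s + t) = (T s).comp (T t)) ∧
    (∀ x, Continuous fun t => T t x) ∧
    ∀ x z, (x, z) ∈ A.graph ↔
      Tendsto (fun t : NNReal => ((t : ℝ) : ℂ)⁻¹ • (T t x - x)) (𝓝[≠] 0) (𝓝 z)

open Classical in
/-- A fixed element of `ρ(A)` (when there is one). -/
def basePoint (A : X →ₗ.[ℂ] X) : ℂ :=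
  if h : (resolventSet A).Nonempty then h.some else 0

/-- The space `X` equipped with the norm `‖(lam₀ - A)⁻¹ x‖`, where `lam₀ ∈ ρ(A)` is fixed. -/
def PreExtrap (_A : X →ₗ.[ℂ] X) : Type _ := X

instance (A : X →ₗ.[ℂ] X) : AddCommGroup (PreExtrap A) := inferInstanceAs (AddCommGroup X)

instance (A : X →ₗ.[ℂ] X) : Module ℂ (PreExtrap A) := inferInstanceAs (Module ℂ X)

/-- The map `x ↦ (lam₀ - A)⁻¹ x`, which induces the norm of `PreExtrap A`. -/
def preExtrapMap (A : X →ₗ.[ℂ] X) : PreExtrap A →ₗ[ℂ] X :=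
  (resolvent A (basePoint A)).toLinearMap

instance (A : X →ₗ.[ℂ] X) : SeminormedAddCommGroup (PreExtrap A) :=
  SeminormedAddCommGroup.induced (PreExtrap A) X (preExtrapMap A)

instance (A : X →ₗ.[ℂ] X) : NormedSpace ℂ (PreExtrap A) :=
  NormedSpace.induced ℂ (PreExtrap A) X (preExtrapMap A)

theorem norm_preExtrap (A : X →ₗ.[ℂ] X) (x : X) :
    ‖(show PreExtrap A from x)‖ = ‖resolvent A (basePoint A) x‖ := rfl

/-- The extrapolation space `X₋₁`: the completion of `(X, ‖(lam₀ - A)⁻¹ ·‖)`. -/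
abbrev Extrap (A : X →ₗ.[ℂ] X) : Type _ := UniformSpace.Completion (PreExtrap A)

/-- The identity `X → (X, ‖(lam₀ - A)⁻¹ ·‖)` as a bounded operator. -/
def toPreExtrap (A : X →ₗ.[ℂ] X) : X →L[ℂ] PreExtrap A :=
  LinearMap.mkContinuous
    ({ toFun := fun x => x, map_add' := fun _ _ => rfl, map_smul' := fun _ _ => rfl } :
      X →ₗ[ℂ] PreExtrap A)
    ‖resolvent A (basePoint A)‖
    (fun x => (resolvent A (basePoint A)).le_opNorm x)

/-- The canonical map `X → X₋₁`. -/
def toExtrap (A : X →ₗ.[ℂ] X) : X →L[ℂ] Extrap A :=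
  (UniformSpace.Completion.toComplL (𝕜 := ℂ) (E := PreExtrap A)).comp (toPreExtrap A)

open Classical in
/-- The extension of `A` to a bounded operator `X → X₋₁` (unique when `D(A)` is dense). -/
def extOp (A : X →ₗ.[ℂ] X) : X →L[ℂ] Extrap A :=
  if h : ∃ T : X →L[ℂ] Extrap A, ∀ x : A.domain, T x = toExtrap A (A x) then h.choose else 0

/-- The resolvent `(lam - A)⁻¹ : X₋₁ → X` of the extension `A : X → X₋₁`. -/
def extResolvent (A : X →ₗ.[ℂ] X) (lam : ℂ) : Extrap A →L[ℂ] X :=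
  ContinuousLinearMap.inverse (lam • toExtrap A - extOp A)

end Operators

/-! ### System nodes

A system node on `(U, X, Y)` is a partially defined operator `S` from `X × U` to `X × Y`. Products
carry Mathlib's product norm, which is equivalent to the Hilbert product norm; only the topology
of the products matters below. -/

section Nodes

variable {X U Y : Type*} [NormedAddCommGroup X] [NormedSpace ℂ X]
  [NormedAddCommGroup U] [NormedSpace ℂ U] [NormedAddCommGroup Y] [NormedSpace ℂ Y]

/-- The operator `A x = A&B (x, 0)` with domain `{x | (x, 0) ∈ D(S)}`. -/
def mainOp (S : X × U →ₗ.[ℂ] X × Y) : X →ₗ.[ℂ] X where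
  domain := S.domain.comap (LinearMap.inl ℂ X U)
  toFun := (LinearMap.fst ℂ X Y).comp
    (S.toFun.comp ((LinearMap.inl ℂ X U).submoduleComap S.domain))

/-- `A&B` extends to `[A, B] : X × U → X₋₁`, and `D(S) = {(x, u) | A x + B u ∈ X}`. -/
def IsControlOp (S : X × U →ₗ.[ℂ] X × Y) (B : U →L[ℂ] Extrap (mainOp S)) : Prop :=
  (∀ p : S.domain, toExtrap (mainOp S) (S p).1 = extOp (mainOp S) p.1.1 + B p.1.2) ∧
    ∀ (x : X) (u : U), (x, u) ∈ S.domain ↔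
      ∃ z : X, toExtrap (mainOp S) z = extOp (mainOp S) x + B u

/-- System nodes on `(U, X, Y)`. -/
structure IsSystemNode (S : X × U →ₗ.[ℂ] X × Y) : Prop where
  closed : S.IsClosed
  generates : GeneratesC0Semigroup (mainOp S)
  exists_controlOp : ∃ B : U →L[ℂ] Extrap (mainOp S), IsControlOp S B

open Classical in
/-- The control operator `B : U → X₋₁` of `S`. -/
def controlOp (S : X × U →ₗ.[ℂ] X × Y) : U →L[ℂ] Extrap (mainOp S) :=
  if h : ∃ B : U →L[ℂ] Extrap (mainOp S), IsControlOp S B then h.choose else 0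

open Classical in
/-- The transfer function `P(lam) u = C&D ((lam - A)⁻¹ B u, u)` for `lam ∈ ρ(A)`. -/
def transfer (S : X × U →ₗ.[ℂ] X × Y) (lam : ℂ) : U →L[ℂ] Y :=
  if h : ∃ P : U →L[ℂ] Y, ∀ u : U,
      ∃ hu : (extResolvent (mainOp S) lam (controlOp S u), u) ∈ S.domain, P u = (S ⟨_, hu⟩).2
  then h.choose else 0

/-- Classical trajectories on `[0, ∞)`: `x` is continuously differentiable, `u` and `y` are
continuous, and `(x'(t), y(t)) = S (x(t), u(t))` for all `t ≥ 0`. -/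
def IsClassicalTrajectory (S : X × U →ₗ.[ℂ] X × Y) (x : ℝ → X) (u : ℝ → U) (y : ℝ → Y) : Prop :=
  ContinuousOn u (Set.Ici 0) ∧ ContinuousOn y (Set.Ici 0) ∧
    ∃ dx : ℝ → X, ContinuousOn dx (Set.Ici 0) ∧
      ∀ t, 0 ≤ t → HasDerivWithinAt x (dx t) (Set.Ici 0) t ∧
        ∃ h : (x t, u t) ∈ S.domain, S ⟨(x t, u t), h⟩ = (dx t, y t)

/-- Well-posed system nodes: on every interval `[0, τ]` the final state and the `L²` norm of the
output of classical trajectories are bounded by the initial state and the `L²` norm of the input. -/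
structure IsWellPosedNode (S : X × U →ₗ.[ℂ] X × Y) : Prop extends IsSystemNode S where
  estimate : ∀ τ : ℝ, 0 < τ → ∃ K : ℝ, ∀ x u y, IsClassicalTrajectory S x u y →
    ‖x τ‖ ^ 2 + ∫ t in (0 : ℝ)..τ, ‖y t‖ ^ 2 ≤ K * (‖x 0‖ ^ 2 + ∫ t in (0 : ℝ)..τ, ‖u t‖ ^ 2)

/-- The map `((x, u), (z, y)) ↦ ((x, u + K y), (z, y))`. -/
def feedbackMap (K : Y →L[ℂ] U) : ((X × U) × (X × Y)) →ₗ[ℂ] ((X × U) × (X × Y)) where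
  toFun p := ((p.1.1, p.1.2 + K p.2.2), p.2)
  map_add' p q := by
    simp only [Prod.fst_add, Prod.snd_add, map_add, Prod.mk_add_mk, Prod.mk.injEq, and_true,
      true_and]
    abel
  map_smul' c p := by simp

/-- The graph of the closed-loop node:
`((x, u), (z, y))` belongs to it iff `(x, u + K y) ∈ D(S)` and `S (x, u + K y) = (z, y)`. -/
def closedLoopGraph (S : X × U →ₗ.[ℂ] X × Y) (K : Y →L[ℂ] U) :
    Submodule ℂ ((X × U) × (X × Y)) :=
  S.graph.comap (feedbackMap K)

/-- The closed-loop system node `S^K` of `S` under the output feedback `u ↦ K y + u`, that is,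
`S^K (x, u) = (z, y)` iff `S (x, u + K y) = (z, y)`. (This is an operator when the right-hand side
determines `(z, y)` uniquely, which is part of the admissibility of the feedback operator `K`.) -/
def closedLoop (S : X × U →ₗ.[ℂ] X × Y) (K : Y →L[ℂ] U) : X × U →ₗ.[ℂ] X × Y :=
  (closedLoopGraph S K).toLinearPMap

end Nodes

/-! ### Systems with control input in `U`, disturbance input in `Ud` and output in `U` -/

section Control

variable {X U Ud : Type*} [NormedAddCommGroup X] [InnerProductSpace ℂ X]
  [NormedAddCommGroup U] [InnerProductSpace ℂ U]
  [NormedAddCommGroup Ud] [InnerProductSpace ℂ Ud]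

/-- `Re ⟨A&B (x, u, 0), x⟩ ≤ Re ⟨C&D (x, u, 0), u⟩` for all `(x, u, 0) ∈ D(S)`. -/
def IsImpedancePassive (S : X × (U × Ud) →ₗ.[ℂ] X × U) : Prop :=
  ∀ (x : X) (u : U) (h : (x, (u, (0 : Ud))) ∈ S.domain),
    (⟪(S ⟨_, h⟩).1, x⟫_ℂ).re ≤ (⟪(S ⟨_, h⟩).2, u⟫_ℂ).re

/-- The component `P_c(lam)` of the transfer function `P = [P_c, P_d]`. -/
def transferC (S : X × (U × Ud) →ₗ.[ℂ] X × U) (lam : ℂ) : U →L[ℂ] U :=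
  (transfer S lam).comp (ContinuousLinearMap.inl ℂ U Ud)

/-- The component `P_d(lam)` of the transfer function `P = [P_c, P_d]`. -/
def transferD (S : X × (U × Ud) →ₗ.[ℂ] X × U) (lam : ℂ) : Ud →L[ℂ] U :=
  (transfer S lam).comp (ContinuousLinearMap.inr ℂ U Ud)

/-- The component `B_c` of the control operator `B = [B_c, B_d]`. -/
def controlC (S : X × (U × Ud) →ₗ.[ℂ] X × U) : U →L[ℂ] Extrap (mainOp S) :=
  (controlOp S).comp (ContinuousLinearMap.inl ℂ U Ud)

/-- The component `B_d` of the control operator `B = [B_c, B_d]`. -/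
def controlD (S : X × (U × Ud) →ₗ.[ℂ] X × U) : Ud →L[ℂ] Extrap (mainOp S) :=
  (controlOp S).comp (ContinuousLinearMap.inr ℂ U Ud)

/-- `Re T = (T + T⋆) / 2`. -/
def reOp [CompleteSpace U] (T : U →L[ℂ] U) : U →L[ℂ] U :=
  (1 / 2 : ℂ) • (T + ContinuousLinearMap.adjoint T)

/-- The system node is well-posed, it is impedance passive for zero disturbance, and
`Re P_c(lam) ≥ c I` for some `lam, c > 0`. -/
structure PassivityAssumption [CompleteSpace U] (S : X × (U × Ud) →ₗ.[ℂ] X × U) : Prop where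
  wellPosed : IsWellPosedNode S
  passive : IsImpedancePassive S
  coercive : ∃ lam c : ℝ, 0 < lam ∧ 0 < c ∧ (lam : ℂ) ∈ resolventSet (mainOp S) ∧
    (reOp (transferC S lam) - (c : ℂ) • ContinuousLinearMap.id ℂ U).IsPositive

/-- The feedback operator `(-κ I, 0) : U → U × Ud`. -/
def feedbackOp (U Ud : Type*) [NormedAddCommGroup U] [InnerProductSpace ℂ U]
    [NormedAddCommGroup Ud] [InnerProductSpace ℂ Ud] (κ : ℝ) : U →L[ℂ] U × Ud :=
  (-(κ : ℂ)) • ContinuousLinearMap.inl ℂ U Ud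

/-- The closed-loop node `S^κ` of `S` with the output feedback `u = -κ y + ũ`. -/
def kappaNode (S : X × (U × Ud) →ₗ.[ℂ] X × U) (κ : ℝ) : X × (U × Ud) →ₗ.[ℂ] X × U :=
  closedLoop S (feedbackOp U Ud κ)

/-- The operator `A^κ`. -/
def kappaGen (S : X × (U × Ud) →ₗ.[ℂ] X × U) (κ : ℝ) : X →ₗ.[ℂ] X := mainOp (kappaNode S κ)

theorem mem_closedLoopGraph_iff (S : X × (U × Ud) →ₗ.[ℂ] X × U) (κ : ℝ)
    (x z : X) (u y : U) (w : Ud) :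
    ((x, (u, w)), (z, y)) ∈ closedLoopGraph S (feedbackOp U Ud κ) ↔
      ∃ h : (x, (u - (κ : ℂ) • y, w)) ∈ S.domain, S ⟨_, h⟩ = (z, y) := by
  have : feedbackMap (X := X) (feedbackOp U Ud κ) ((x, (u, w)), (z, y))
      = ((x, (u - (κ : ℂ) • y, w)), (z, y)) := by
    simp [feedbackMap, feedbackOp, sub_eq_add_neg]
  rw [closedLoopGraph, Submodule.mem_comap, this, LinearPMap.mem_graph_iff]
  constructor
  · rintro ⟨⟨p, hp'⟩, hp, hS⟩
    obtain rfl : p = (x, (u - (κ : ℂ) • y, w)) := hp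
    exact ⟨hp', hS⟩
  · rintro ⟨h, hS⟩
    exact ⟨⟨_, h⟩, rfl, hS⟩

/-- For an impedance passive node and `κ ≥ 0` the closed-loop graph is the graph of an operator. -/
theorem kappaNode_graph {S : X × (U × Ud) →ₗ.[ℂ] X × U} (hS : IsImpedancePassive S) {κ : ℝ}
    (hκ : 0 ≤ κ) : (kappaNode S κ).graph = closedLoopGraph S (feedbackOp U Ud κ) := by
  refine Submodule.toLinearPMap_graph_eq _ ?_
  rintro ⟨⟨x, u, w⟩, z, y⟩ hg h0
  obtain ⟨rfl, rfl, rfl⟩ : x = 0 ∧ u = 0 ∧ w = 0 := by simpa using h0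
  obtain ⟨h, hSv⟩ := (mem_closedLoopGraph_iff S κ _ _ _ _ _).1 hg
  have key := hS _ _ h
  rw [hSv] at key
  have hy : κ = 0 ∨ y = 0 := by
    rcases hκ.eq_or_lt with h | h
    · exact Or.inl h.symm
    · right
      have e : (⟪y, (0 : U) - (κ : ℂ) • y⟫_ℂ).re = -(κ * ‖y‖ ^ 2) := by
        rw [zero_sub, inner_neg_right, inner_smul_right, inner_self_eq_norm_sq_to_K]
        simp [← Complex.ofReal_pow]
      rw [e, inner_zero_right, Complex.zero_re] at key
      have : ‖y‖ ^ 2 = 0 := le_antisymm (by nlinarith) (by positivity)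
      simpa using this
  have hp : (⟨_, h⟩ : S.domain) = 0 := by
    ext1
    rcases hy with rfl | rfl <;> simp
  rw [hp, LinearPMap.map_zero] at hSv
  exact hSv.symm

/-- `D(A^κ) = {x | ∃ v, (x, -κ v, 0) ∈ D(S), v = C&D (x, -κ v, 0)}`, and
`A^κ x = A&B (x, -κ v, 0)` for this `v`. -/
theorem mem_kappaGen_graph_iff {S : X × (U × Ud) →ₗ.[ℂ] X × U} (hS : IsImpedancePassive S) {κ : ℝ}
    (hκ : 0 ≤ κ) (x z : X) : (x, z) ∈ (kappaGen S κ).graph ↔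
      ∃ (v : U) (h : (x, (-((κ : ℂ) • v), (0 : Ud))) ∈ S.domain), S ⟨_, h⟩ = (z, v) := by
  have key : (x, z) ∈ (kappaGen S κ).graph ↔
      ∃ v, ((x, ((0 : U), (0 : Ud))), (z, v)) ∈ (kappaNode S κ).graph := by
    constructor
    · intro h
      obtain ⟨⟨p, hp⟩, hpx, hpz⟩ := (LinearPMap.mem_graph_iff _).1 h
      obtain rfl : p = x := hpx
      obtain rfl : ((kappaNode S κ) ⟨(p, ((0 : U), (0 : Ud))), hp⟩).1 = z := hpz
      exact ⟨_, (LinearPMap.mem_graph_iff _).2 ⟨⟨_, hp⟩, rfl, rfl⟩⟩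
    · rintro ⟨v, h⟩
      obtain ⟨⟨p, hp⟩, hpx, hpz⟩ := (LinearPMap.mem_graph_iff _).1 h
      obtain rfl : p = (x, ((0 : U), (0 : Ud))) := hpx
      refine (LinearPMap.mem_graph_iff _).2 ⟨⟨x, hp⟩, rfl, ?_⟩
      exact congrArg Prod.fst hpz
  rw [key, kappaNode_graph hS hκ]
  simp_rw [mem_closedLoopGraph_iff, zero_sub]

/-! ### The regulator equations -/

/-- `(Π, Γ)` satisfies `ran (Π, Γ, E) ⊆ D(S)` and `(Π A_exo, F) = S (Π, Γ, E)`. -/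
def SolvesRegulatorEquations {q : ℕ} (S : X × (U × Ud) →ₗ.[ℂ] X × U)
    (Aexo : Matrix (Fin q) (Fin q) ℂ)
    (E : EuclideanSpace ℂ (Fin q) →L[ℂ] Ud) (F : EuclideanSpace ℂ (Fin q) →L[ℂ] U)
    (Pi : EuclideanSpace ℂ (Fin q) →L[ℂ] X) (Gam : EuclideanSpace ℂ (Fin q) →L[ℂ] U) : Prop :=
  ∀ v : EuclideanSpace ℂ (Fin q), ∃ h : (Pi v, (Gam v, E v)) ∈ S.domain,
    (Pi (Matrix.toEuclideanLin Aexo v), F v) = S ⟨_, h⟩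

end Control

end SysNode

end

/-!
The regulator equations are linear, and a skew-Hermitian `A_exo` has a basis of eigenvectors `φ_k`,
so they need only be solved on each `φ_k`. There they read
`S (Π φ_k, Γ φ_k, E φ_k) = (λ_k Π φ_k, F φ_k)`. Writing the input as `u - κ y` with the known output
`y = F φ_k`, this is the equation `S^κ (Π φ_k, Γ φ_k + κ F φ_k, E φ_k) = (λ_k Π φ_k, F φ_k)` of the
closed loop, and as `λ_k ∈ ρ(A^κ)` it holds exactly when
`Π φ_k = (λ_k - A^κ)⁻¹ B^κ (Γ φ_k + κ F φ_k, E φ_k)` and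
`F φ_k = P^κ(λ_k) (Γ φ_k + κ F φ_k, E φ_k)` (`SysNode.mem_graph_iff_kappa`). The second equation is
solved for `Γ φ_k` with the inverse of `P_c^κ(λ_k)`, and then the first one gives `Π φ_k`.

What has to be shown is that the operators `A^κ`, `B^κ` and `P^κ` of the closed loop really have
these properties. For a closed node whose main operator is densely defined with nonempty resolvent
set, and for which every input `u` admits some `x` with `(x, u)` in the domain, the control operator
exists, and the resolvent on `X₋₁` and the transfer function describe the solutions of
`(lam x, y) = T (x, u)` at every `lam ∈ ρ(A)` (`SysNode.isControlOp_controlOp`,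
`SysNode.mem_graph_iff_transfer`); boundedness comes from the closed graph theorem. By impedance
passivity both `A` and `A^κ` are dissipative, and a dissipative operator on a Hilbert space with
`lam - A` onto for some `lam > 0` is densely defined with `lam ∈ ρ(A)`
(`SysNode.mem_resolventSet_of_dissipative`, `SysNode.dense_domain_of_dissipative`). At the point
where `Re P_c(lam) ≥ c`, the operator `I + κ P_c(lam)` is invertible, which makes the closed-loop
equations solvable for all data (`SysNode.exists_kappaNode_solution`). This settles all
requirements on `S^κ`.
-/

open Filter Topology MeasureTheory
open scoped InnerProductSpace

noncomputable section

namespace SysNode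

/-! ### Resolvents and the extrapolation space -/

section Extrapolation

variable {X : Type*} [NormedAddCommGroup X] [NormedSpace ℂ X]

theorem isResolventAt_resolvent {A : X →ₗ.[ℂ] X} {lam : ℂ} (h : lam ∈ resolventSet A) :
    IsResolventAt A lam (resolvent A lam) := by
  have hex : ∃ R : X →L[ℂ] X, IsResolventAt A lam R := h
  rw [resolvent, dif_pos hex]
  exact hex.choose_spec

theorem resolvent_mem_graph {A : X →ₗ.[ℂ] X} {lam : ℂ} (h : lam ∈ resolventSet A) (y : X) :
    (resolvent A lam y, lam • resolvent A lam y - y) ∈ A.graph := by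
  obtain ⟨hy, e⟩ := (isResolventAt_resolvent h).1 y
  refine (LinearPMap.mem_graph_iff _).2 ⟨⟨_, hy⟩, rfl, ?_⟩
  exact eq_sub_of_add_eq (sub_eq_iff_eq_add'.1 e).symm

theorem resolvent_of_mem_graph {A : X →ₗ.[ℂ] X} {lam : ℂ} (h : lam ∈ resolventSet A) {x z : X}
    (hx : (x, z) ∈ A.graph) : resolvent A lam (lam • x - z) = x := by
  obtain ⟨p, rfl, rfl⟩ := (LinearPMap.mem_graph_iff _).1 hx
  exact (isResolventAt_resolvent h).2 p

theorem basePoint_mem {A : X →ₗ.[ℂ] X} (h : (resolventSet A).Nonempty) :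
    basePoint A ∈ resolventSet A := by
  rw [basePoint, dif_pos h]
  exact h.some_mem

/-- The continuous extension `X₋₁ → X` of the resolvent at the base point. It is isometric, because
the norm of `X₋₁` is defined through that resolvent. -/
def extrapMap [CompleteSpace X] (A : X →ₗ.[ℂ] X) : Extrap A →L[ℂ] X :=
  ContinuousLinearMap.extend
    ((preExtrapMap A).mkContinuous 1 fun x => (one_mul ‖x‖).symm.le)
    (UniformSpace.Completion.toComplL (𝕜 := ℂ) (E := PreExtrap A))

variable [CompleteSpace X]

theorem extrapMap_coe (A : X →ₗ.[ℂ] X) (x : PreExtrap A) :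
    extrapMap A (x : Extrap A) = preExtrapMap A x :=
  ContinuousLinearMap.extend_eq
    (f := (preExtrapMap A).mkContinuous 1 fun x => (one_mul ‖x‖).symm.le)
    (e := UniformSpace.Completion.toComplL (𝕜 := ℂ) (E := PreExtrap A))
    UniformSpace.Completion.denseRange_coe
    (UniformSpace.Completion.isUniformInducing_coe _) x

@[simp]
theorem extrapMap_toExtrap (A : X →ₗ.[ℂ] X) (x : X) :
    extrapMap A (toExtrap A x) = resolvent A (basePoint A) x :=
  extrapMap_coe A _

theorem norm_extrapMap (A : X →ₗ.[ℂ] X) (η : Extrap A) : ‖extrapMap A η‖ = ‖η‖ := by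
  induction η using UniformSpace.Completion.induction_on with
  | hp => exact isClosed_eq (extrapMap A).continuous.norm continuous_norm
  | ih x =>
    rw [extrapMap_coe, UniformSpace.Completion.norm_coe]
    rfl

theorem extrapMap_isometry (A : X →ₗ.[ℂ] X) : Isometry (extrapMap A) :=
  AddMonoidHomClass.isometry_of_norm _ (norm_extrapMap A)

variable {A : X →ₗ.[ℂ] X}

theorem toExtrap_injective (hr : (resolventSet A).Nonempty) :
    Function.Injective (toExtrap A) := by
  refine (injective_iff_map_eq_zero _).2 fun x hx => ?_
  have h0 : resolvent A (basePoint A) x = 0 := by rw [← extrapMap_toExtrap, hx, map_zero]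
  have hg := resolvent_mem_graph (basePoint_mem hr) x
  rw [h0, smul_zero, zero_sub] at hg
  simpa using LinearPMap.graph_fst_eq_zero_snd _ hg rfl

/-- The resolvent at the base point maps `X` onto the dense subspace `D(A)`, so its isometric
extension is onto. -/
theorem extrapMap_surjective (hr : (resolventSet A).Nonempty) (hd : Dense (A.domain : Set X)) :
    Function.Surjective (extrapMap A) := by
  have hc : IsClosed (Set.range (extrapMap A)) :=
    (extrapMap_isometry A).isClosedEmbedding.isClosed_range
  have hsub : (A.domain : Set X) ⊆ Set.range (extrapMap A) := by
    intro x hx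
    refine ⟨toExtrap A (basePoint A • x - A ⟨x, hx⟩), ?_⟩
    rw [extrapMap_toExtrap]
    exact resolvent_of_mem_graph (basePoint_mem hr) (A.mem_graph ⟨x, hx⟩)
  exact Set.range_eq_univ.1 (hc.closure_eq ▸ (hd.mono hsub).closure_eq)

theorem extOp_of_mem_graph (hr : (resolventSet A).Nonempty) (hd : Dense (A.domain : Set X))
    {x z : X} (hx : (x, z) ∈ A.graph) : extOp A x = toExtrap A z := by
  have hex : ∃ T : X →L[ℂ] Extrap A, ∀ x : A.domain, T x = toExtrap A (A x) := by
    let e : Extrap A ≃ₗᵢ[ℂ] X := LinearIsometryEquiv.ofSurjective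
      ⟨(extrapMap A).toLinearMap, norm_extrapMap A⟩ (extrapMap_surjective hr hd)
    refine ⟨(e.symm.toContinuousLinearEquiv : X →L[ℂ] Extrap A).comp
      (basePoint A • resolvent A (basePoint A) - ContinuousLinearMap.id ℂ X), fun x => ?_⟩
    have h1 := resolvent_of_mem_graph (basePoint_mem hr) (A.mem_graph x)
    rw [map_sub, map_smul, sub_eq_iff_eq_add'] at h1
    refine e.symm_apply_eq.2 ?_
    change _ = extrapMap A (toExtrap A (A x))
    rw [extrapMap_toExtrap]
    simp [h1]
  obtain ⟨p, rfl, rfl⟩ := (LinearPMap.mem_graph_iff _).1 hx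
  rw [extOp, dif_pos hex]
  exact hex.choose_spec p

theorem extrapMap_extOp (hr : (resolventSet A).Nonempty) (hd : Dense (A.domain : Set X)) (x : X) :
    extrapMap A (extOp A x) = basePoint A • resolvent A (basePoint A) x - x := by
  refine congrFun (Continuous.ext_on hd (f := fun x => extrapMap A (extOp A x))
    (g := fun x => basePoint A • resolvent A (basePoint A) x - x)
    (by fun_prop) (by fun_prop) fun x hx => ?_) x
  have hg := A.mem_graph ⟨x, hx⟩
  have h1 := resolvent_of_mem_graph (basePoint_mem hr) hg
  rw [map_sub, map_smul, sub_eq_iff_eq_add'] at h1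
  simp only [extOp_of_mem_graph hr hd hg, extrapMap_toExtrap]
  rw [h1]
  simp

theorem pencil_resolvent (hd : Dense (A.domain : Set X)) {lam : ℂ} (h : lam ∈ resolventSet A)
    (y : X) : (lam • toExtrap A - extOp A) (resolvent A lam y) = toExtrap A y := by
  simp [extOp_of_mem_graph ⟨lam, h⟩ hd (resolvent_mem_graph h y)]

/-- For `lam ∈ ρ(A)` the extension `lam - A : X → X₋₁` is bijective. -/
theorem pencil_bijective (hd : Dense (A.domain : Set X)) {lam : ℂ} (h : lam ∈ resolventSet A) :
    Function.Bijective (lam • toExtrap A - extOp A) := by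
  have hr : (resolventSet A).Nonempty := ⟨lam, h⟩
  constructor
  · refine (injective_iff_map_eq_zero _).2 fun x hx => ?_
    -- Applying `extrapMap` shows `x` to lie in the range of a resolvent, hence in `D(A)`.
    have h1 := congrArg (extrapMap A) hx
    have h2 : x = resolvent A (basePoint A) ((basePoint A - lam) • x) := by
      simp only [sub_apply, smul_apply, map_sub, map_smul,
        extrapMap_toExtrap, extrapMap_extOp hr hd, map_zero] at h1
      rw [map_smul, sub_smul, ← sub_eq_zero, ← h1]
      abel
    have hg := resolvent_mem_graph (basePoint_mem hr) ((basePoint A - lam) • x)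
    rw [← h2] at hg
    have h3 : toExtrap A (lam • x) = extOp A x := by
      simpa [sub_eq_zero] using hx
    rw [extOp_of_mem_graph hr hd hg] at h3
    have h4 := resolvent_of_mem_graph h hg
    rw [← toExtrap_injective hr h3, sub_self, map_zero] at h4
    exact h4.symm
  · intro η
    have h0 : (basePoint A • toExtrap A - extOp A) (extrapMap A η) = η := by
      refine (extrapMap_isometry A).injective ?_
      simp [extrapMap_extOp hr hd]
    -- The preimage of `η` under the pencil at the base point, corrected by the resolvent at `lam`.
    refine ⟨extrapMap A η + (basePoint A - lam) • resolvent A lam (extrapMap A η), ?_⟩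
    rw [map_add, map_smul, pencil_resolvent hd h]
    conv_rhs => rw [← h0]
    simp only [sub_apply, smul_apply, sub_smul]
    abel

/-- On `ρ(A)` the operator `extResolvent A lam` is the inverse of `lam - A : X → X₋₁`. -/
theorem extResolvent_eq_iff (hd : Dense (A.domain : Set X)) {lam : ℂ} (h : lam ∈ resolventSet A)
    (η : Extrap A) (x : X) :
    x = extResolvent A lam η ↔ lam • toExtrap A x = extOp A x + η := by
  have hb := pencil_bijective hd h
  let e : X ≃L[ℂ] Extrap A := ContinuousLinearEquiv.ofBijective (lam • toExtrap A - extOp A)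
    (LinearMap.ker_eq_bot.2 hb.1) (LinearMap.range_eq_top.2 hb.2)
  have he : (e : X →L[ℂ] Extrap A) = lam • toExtrap A - extOp A := rfl
  have : extResolvent A lam = e.symm := by
    rw [extResolvent, ← he, ContinuousLinearMap.inverse_equiv]
  rw [this]
  refine (ContinuousLinearEquiv.eq_symm_apply e).trans ?_
  change lam • toExtrap A x - extOp A x = η ↔ _
  rw [sub_eq_iff_eq_add']

/-- The domain of `A` consists of the vectors that its extension maps into `X`. -/
theorem mem_graph_of_extOp_eq (hd : Dense (A.domain : Set X)) (hr : (resolventSet A).Nonempty)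
    {x z : X} (hx : extOp A x = toExtrap A z) : (x, z) ∈ A.graph := by
  obtain ⟨lam, h⟩ := hr
  have h1 : x = resolvent A lam (lam • x - z) := by
    refine (pencil_bijective hd h).1 ?_
    rw [pencil_resolvent hd h]
    simp [hx]
  have h2 := resolvent_mem_graph h (lam • x - z)
  rw [← h1] at h2
  simpa using h2

end Extrapolation

/-! ### Dissipative operators on a Hilbert space -/

section Dissipative

variable {X : Type*} [NormedAddCommGroup X] [InnerProductSpace ℂ X]

/-- The resolvent estimate of dissipative operators, for a single pair `(x, z)` of the graph. -/
theorem norm_le_of_dissipative {lam : ℝ} {x z : X} (h : (⟪z, x⟫_ℂ).re ≤ 0) :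
    lam * ‖x‖ ≤ ‖(lam : ℂ) • x - z‖ := by
  have h1 : lam * ‖x‖ * ‖x‖ ≤ (⟪(lam : ℂ) • x - z, x⟫_ℂ).re := by
    rw [inner_sub_left, inner_smul_left, inner_self_eq_norm_sq_to_K]
    simp only [Complex.sub_re, Complex.conj_ofReal, Complex.coe_algebraMap, ← Complex.ofReal_pow,
      ← Complex.ofReal_mul, Complex.ofReal_re]
    nlinarith
  have h2 : (⟪(lam : ℂ) • x - z, x⟫_ℂ).re ≤ ‖(lam : ℂ) • x - z‖ * ‖x‖ :=
    re_inner_le_norm (𝕜 := ℂ) _ _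
  rcases (norm_nonneg x).eq_or_lt with h0 | h0
  · rw [← h0, mul_zero]
    exact norm_nonneg _
  · exact le_of_mul_le_mul_right (h1.trans h2) h0

theorem mem_resolventSet_of_dissipative {A : X →ₗ.[ℂ] X} {lam : ℝ} (hlam : 0 < lam)
    (hA : ∀ x z, (x, z) ∈ A.graph → (⟪z, x⟫_ℂ).re ≤ 0)
    (hs : ∀ y, ∃ x z, (x, z) ∈ A.graph ∧ (lam : ℂ) • x - z = y) :
    (lam : ℂ) ∈ resolventSet A := by
  choose f g hg hfg using hs
  have huniq : ∀ {x z}, (x, z) ∈ A.graph → f ((lam : ℂ) • x - z) = x := by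
    intro x z hx
    have hd := A.graph.sub_mem (hg ((lam : ℂ) • x - z)) hx
    have h1 := norm_le_of_dissipative (lam := lam) (hA _ _ hd)
    have h2 : (lam : ℂ) • (f ((lam : ℂ) • x - z) - x) - (g ((lam : ℂ) • x - z) - z) = 0 := by
      rw [smul_sub, sub_sub_sub_comm, hfg, sub_self]
    rw [h2, norm_zero] at h1
    have h3 : ‖f ((lam : ℂ) • x - z) - x‖ ≤ 0 := by
      by_contra! hc
      nlinarith
    exact sub_eq_zero.1 (norm_le_zero_iff.1 h3)
  let R : X →ₗ[ℂ] X :=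
    { toFun := f
      map_add' := fun y y' => by
        rw [← huniq (A.graph.add_mem (hg y) (hg y'))]
        simp only [smul_add, add_sub_add_comm, hfg]
      map_smul' := fun c y => by
        rw [RingHom.id_apply, ← huniq (A.graph.smul_mem c (hg y))]
        simp only [smul_comm (lam : ℂ) c, ← smul_sub, hfg] }
  refine ⟨R.mkContinuous lam⁻¹ fun y => ?_, fun y => ?_, fun x => huniq (A.mem_graph x)⟩
  · rw [inv_mul_eq_div, le_div_iff₀' hlam]
    have := norm_le_of_dissipative (lam := lam) (hA _ _ (hg y))
    rwa [hfg] at this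
  · obtain ⟨p, hp, hp'⟩ := (LinearPMap.mem_graph_iff _).1 (hg y)
    obtain ⟨x, hx⟩ := p
    obtain rfl : x = f y := hp
    refine ⟨hx, ?_⟩
    change (lam : ℂ) • f y - A ⟨f y, hx⟩ = y
    rw [hp', hfg]

/-- A maximal dissipative operator on a Hilbert space is densely defined: a vector orthogonal to
`D(A)` has the form `lam x - A x`, and pairing it with `x` yields `lam ‖x‖² ≤ 0`. -/
theorem dense_domain_of_dissipative [CompleteSpace X] {A : X →ₗ.[ℂ] X} {lam : ℝ} (hlam : 0 < lam)
    (hA : ∀ x z, (x, z) ∈ A.graph → (⟪z, x⟫_ℂ).re ≤ 0) (h : (lam : ℂ) ∈ resolventSet A) :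
    Dense (A.domain : Set X) := by
  rw [Submodule.dense_iff_topologicalClosure_eq_top,
    Submodule.topologicalClosure_eq_top_iff, Submodule.eq_bot_iff]
  intro w hw
  have hg := resolvent_mem_graph h w
  set x := resolvent A lam w
  have h0 : ⟪x, w⟫_ℂ = 0 := hw x (LinearPMap.mem_domain_of_mem_graph hg)
  have h1 : (⟪(lam : ℂ) • x - w, x⟫_ℂ).re = lam * ‖x‖ ^ 2 := by
    rw [inner_sub_left, inner_smul_left, inner_self_eq_norm_sq_to_K, inner_eq_zero_symm.1 h0]
    simp [← Complex.ofReal_pow]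
  have h2 := hA _ _ hg
  rw [h1] at h2
  have h3 : x = 0 := by
    have : ‖x‖ ^ 2 = 0 := le_antisymm (by nlinarith) (by positivity)
    simpa using this
  rw [h3, smul_zero, zero_sub] at hg
  simpa using LinearPMap.graph_fst_eq_zero_snd _ hg rfl

end Dissipative

/-! ### Control operators and transfer functions of closed nodes -/

section ClosedNodes

variable {X U Y : Type*} [NormedAddCommGroup X] [NormedSpace ℂ X]
  [NormedAddCommGroup U] [NormedSpace ℂ U] [NormedAddCommGroup Y] [NormedSpace ℂ Y]

theorem mem_graph_iff_exists {V W : Type*} [AddCommGroup V] [Module ℂ V] [AddCommGroup W]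
    [Module ℂ W] (T : V →ₗ.[ℂ] W) (v : V) (w : W) :
    (v, w) ∈ T.graph ↔ ∃ h : v ∈ T.domain, T ⟨v, h⟩ = w := by
  rw [LinearPMap.mem_graph_iff]
  constructor
  · rintro ⟨⟨p, hp⟩, rfl, h⟩
    exact ⟨hp, h⟩
  · rintro ⟨h, h'⟩
    exact ⟨⟨_, h⟩, rfl, h'⟩

theorem mem_mainOp_graph_iff (T : X × U →ₗ.[ℂ] X × Y) (x z : X) :
    (x, z) ∈ (mainOp T).graph ↔ ∃ y, ((x, (0 : U)), (z, y)) ∈ T.graph := by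
  simp_rw [mem_graph_iff_exists]
  constructor
  · rintro ⟨h, rfl⟩
    exact ⟨_, h, rfl⟩
  · rintro ⟨y, h, hy⟩
    exact ⟨h, congrArg Prod.fst hy⟩

variable {T : X × U →ₗ.[ℂ] X × Y} {lam : ℂ}

/-- Solutions of `(lam x, y) = T (x, u)` are unique for `lam ∈ ρ(A)`. -/
theorem eq_of_mem_graph (h : lam ∈ resolventSet (mainOp T)) {u : U} {x x' : X} {y y' : Y}
    (hx : ((x, u), (lam • x, y)) ∈ T.graph) (hx' : ((x', u), (lam • x', y')) ∈ T.graph) :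
    (x, y) = (x', y') := by
  have hd := T.graph.sub_mem hx hx'
  simp only [Prod.mk_sub_mk, sub_self, ← smul_sub] at hd
  have h1 := resolvent_of_mem_graph h ((mem_mainOp_graph_iff T _ _).2 ⟨_, hd⟩)
  rw [sub_self, map_zero] at h1
  rw [← h1, smul_zero] at hd
  have h2 := LinearPMap.graph_fst_eq_zero_snd _ hd rfl
  rw [Prod.ext_iff, ← sub_eq_zero, ← sub_eq_zero (a := y)]
  exact ⟨h1.symm, congrArg Prod.snd h2⟩

/-- For `lam ∈ ρ(A)` the solution `(x, y)` of `(lam x, y) = T (x, u)` depends boundedly on `u`, by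
the closed graph theorem. -/
theorem exists_bounded_solution [CompleteSpace X] [CompleteSpace U] [CompleteSpace Y]
    (hc : T.IsClosed) (h : lam ∈ resolventSet (mainOp T))
    (hu : ∀ u : U, ∃ x, (x, u) ∈ T.domain) :
    ∃ G : U →L[ℂ] X × Y, ∀ u, (((G u).1, u), (lam • (G u).1, (G u).2)) ∈ T.graph := by
  have hsol : ∀ u : U, ∃ p : X × Y, ((p.1, u), (lam • p.1, p.2)) ∈ T.graph := by
    intro u
    obtain ⟨x, hx⟩ := hu u
    obtain ⟨z, y, hg⟩ : ∃ z y, ((x, u), (z, y)) ∈ T.graph := ⟨_, _, T.mem_graph ⟨_, hx⟩⟩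
    obtain ⟨y', hy⟩ := (mem_mainOp_graph_iff T _ _).1 (resolvent_mem_graph h (z - lam • x))
    refine ⟨(x + resolvent (mainOp T) lam (z - lam • x), y + y'), ?_⟩
    have := T.graph.add_mem hg hy
    have e : z + (lam • resolvent (mainOp T) lam (z - lam • x) - (z - lam • x)) =
        lam • (x + resolvent (mainOp T) lam (z - lam • x)) := by
      rw [smul_add]
      abel
    rwa [Prod.mk_add_mk, Prod.mk_add_mk, Prod.mk_add_mk, add_zero, e] at this
  choose g hg using hsol
  have huniq : ∀ {u : U} {p : X × Y}, ((p.1, u), (lam • p.1, p.2)) ∈ T.graph → g u = p :=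
    fun hp => eq_of_mem_graph h (hg _) hp
  let G : U →ₗ[ℂ] X × Y :=
    { toFun := g
      map_add' := fun u u' => huniq (by simpa using T.graph.add_mem (hg u) (hg u'))
      map_smul' := fun c u => huniq (by
        simpa [smul_comm lam c] using T.graph.smul_mem c (hg u)) }
  have hclosed : IsClosed (G.graph : Set (U × (X × Y))) := by
    have : (G.graph : Set (U × (X × Y))) =
        (fun p : U × (X × Y) => ((p.2.1, p.1), (lam • p.2.1, p.2.2))) ⁻¹' T.graph := by
      ext ⟨u, p⟩
      simp only [SetLike.mem_coe, LinearMap.mem_graph_iff, Set.mem_preimage]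
      exact ⟨fun e => e ▸ hg u, fun e => (huniq e).symm⟩
    rw [this]
    exact IsClosed.preimage (by fun_prop) hc
  exact ⟨ContinuousLinearMap.ofIsClosedGraph hclosed, hg⟩

variable [CompleteSpace X]

/-- The control operator is `B = (lam - A) H`, where `x = H u` solves `lam x = A&B (x, u)`. -/
theorem isControlOp_controlOp [CompleteSpace U] [CompleteSpace Y] (hc : T.IsClosed)
    (hd : Dense ((mainOp T).domain : Set X)) (hr : (resolventSet (mainOp T)).Nonempty)
    (hu : ∀ u : U, ∃ x, (x, u) ∈ T.domain) : IsControlOp T (controlOp T) := by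
  have hex : ∃ B : U →L[ℂ] Extrap (mainOp T), IsControlOp T B := by
    obtain ⟨lam, h⟩ := hr
    obtain ⟨G, hG⟩ := exists_bounded_solution hc h hu
    have key : ∀ {x z u y}, ((x, u), (z, y)) ∈ T.graph →
        extOp (mainOp T) (x - (G u).1) = toExtrap (mainOp T) (z - lam • (G u).1) := by
      intro x z u y hx
      refine extOp_of_mem_graph ⟨lam, h⟩ hd ((mem_mainOp_graph_iff T _ _).2 ⟨y - (G u).2, ?_⟩)
      simpa using T.graph.sub_mem hx (hG u)
    refine ⟨(lam • toExtrap (mainOp T) - extOp (mainOp T)).comp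
      ((ContinuousLinearMap.fst ℂ X Y).comp G), fun p => ?_, fun x u => ⟨fun hx => ?_, ?_⟩⟩
    · have := key (T.mem_graph p)
      rw [map_sub, map_sub, map_smul, sub_eq_iff_eq_add] at this
      simp only [ContinuousLinearMap.comp_apply, ContinuousLinearMap.coe_fst', sub_apply,
        smul_apply, this]
      abel
    · have := key (T.mem_graph ⟨_, hx⟩)
      rw [map_sub, map_sub, map_smul, sub_eq_iff_eq_add] at this
      refine ⟨(T ⟨_, hx⟩).1, ?_⟩
      simp only [ContinuousLinearMap.comp_apply, ContinuousLinearMap.coe_fst', sub_apply,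
        smul_apply, this]
      abel
    · rintro ⟨z, hz⟩
      have h1 : extOp (mainOp T) (x - (G u).1) = toExtrap (mainOp T) (z - lam • (G u).1) := by
        rw [map_sub, map_sub, map_smul, hz]
        simp only [ContinuousLinearMap.comp_apply, ContinuousLinearMap.coe_fst', sub_apply,
          smul_apply]
        abel
      obtain ⟨y, hy⟩ := (mem_mainOp_graph_iff T _ _).1 (mem_graph_of_extOp_eq hd ⟨lam, h⟩ h1)
      refine LinearPMap.mem_domain_of_mem_graph (f := T) (y := (z, y + (G u).2)) ?_
      simpa using T.graph.add_mem hy (hG u)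
  rw [controlOp, dif_pos hex]
  exact hex.choose_spec

theorem mem_graph_iff_eq_extResolvent (hd : Dense ((mainOp T).domain : Set X))
    (hB : IsControlOp T (controlOp T)) (h : lam ∈ resolventSet (mainOp T)) (u : U) (x : X) :
    (∃ y, ((x, u), (lam • x, y)) ∈ T.graph) ↔
      x = extResolvent (mainOp T) lam (controlOp T u) := by
  rw [extResolvent_eq_iff hd h]
  constructor
  · rintro ⟨y, hy⟩
    obtain ⟨hx, e⟩ := (mem_graph_iff_exists _ _ _).1 hy
    have := hB.1 ⟨_, hx⟩
    rw [e] at this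
    simpa using this
  · intro e
    rw [← map_smul] at e
    have hx := (hB.2 x u).2 ⟨_, e⟩
    have h1 : (T ⟨_, hx⟩).1 = lam • x :=
      toExtrap_injective ⟨lam, h⟩ ((hB.1 ⟨_, hx⟩).trans e.symm)
    exact ⟨(T ⟨_, hx⟩).2, h1 ▸ T.mem_graph ⟨_, hx⟩⟩

/-- For `lam ∈ ρ(A)` one has `(lam x, y) = T (x, u)` exactly when `x = (lam - A)⁻¹ B u` and
`y = P(lam) u`. -/
theorem mem_graph_iff_transfer [CompleteSpace U] [CompleteSpace Y] (hc : T.IsClosed)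
    (hd : Dense ((mainOp T).domain : Set X)) (hB : IsControlOp T (controlOp T))
    (h : lam ∈ resolventSet (mainOp T)) (u : U) (x : X) (y : Y) :
    ((x, u), (lam • x, y)) ∈ T.graph ↔
      x = extResolvent (mainOp T) lam (controlOp T u) ∧ y = transfer T lam u := by
  have hsol : ∀ u, ∃ y, ((extResolvent (mainOp T) lam (controlOp T u), u),
      (lam • extResolvent (mainOp T) lam (controlOp T u), y)) ∈ T.graph :=
    fun u => (mem_graph_iff_eq_extResolvent hd hB h u _).2 rfl
  have hex : ∃ P : U →L[ℂ] Y, ∀ u : U,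
      ∃ hu : (extResolvent (mainOp T) lam (controlOp T u), u) ∈ T.domain,
        P u = (T ⟨_, hu⟩).2 := by
    obtain ⟨G, hG⟩ := exists_bounded_solution hc h fun u =>
      ⟨_, LinearPMap.mem_domain_of_mem_graph (hsol u).choose_spec⟩
    refine ⟨(ContinuousLinearMap.snd ℂ X Y).comp G, fun u => ?_⟩
    have h1 := (mem_graph_iff_eq_extResolvent hd hB h u _).1 ⟨_, hG u⟩
    have h2 := hG u
    rw [h1] at h2
    obtain ⟨hx, e⟩ := (mem_graph_iff_exists _ _ _).1 h2
    exact ⟨hx, (congrArg Prod.snd e).symm⟩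
  have hP : ((extResolvent (mainOp T) lam (controlOp T u), u),
      (lam • extResolvent (mainOp T) lam (controlOp T u), transfer T lam u)) ∈ T.graph := by
    obtain ⟨y', hy'⟩ := hsol u
    obtain ⟨hx, e⟩ := (mem_graph_iff_exists _ _ _).1 hy'
    rw [transfer, dif_pos hex]
    obtain ⟨hx', e'⟩ := hex.choose_spec u
    rw [e', e]
    exact hy'
  constructor
  · intro hx
    exact Prod.ext_iff.1 (eq_of_mem_graph h hx hP)
  · rintro ⟨rfl, rfl⟩
    exact hP

end ClosedNodes

/-! ### The closed-loop node -/

section ClosedLoop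

variable {X U Ud : Type*} [NormedAddCommGroup X] [InnerProductSpace ℂ X]
  [NormedAddCommGroup U] [InnerProductSpace ℂ U]
  [NormedAddCommGroup Ud] [InnerProductSpace ℂ Ud]
  {S : X × (U × Ud) →ₗ.[ℂ] X × U} {κ : ℝ}

theorem mem_kappaNode_graph_iff (hS : IsImpedancePassive S) (hκ : 0 ≤ κ) (x z : X) (u y : U)
    (w : Ud) : ((x, (u, w)), (z, y)) ∈ (kappaNode S κ).graph ↔
      ((x, (u - (κ : ℂ) • y, w)), (z, y)) ∈ S.graph := by
  rw [kappaNode_graph hS hκ, mem_closedLoopGraph_iff, mem_graph_iff_exists]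

theorem isClosed_kappaNode (hS : IsImpedancePassive S) (hκ : 0 ≤ κ) (hc : S.IsClosed) :
    (kappaNode S κ).IsClosed := by
  have h : Continuous (feedbackMap (X := X) (feedbackOp U Ud κ)) := by
    change Continuous fun p : (X × U × Ud) × (X × U) =>
      ((p.1.1, p.1.2 + feedbackOp U Ud κ p.2.2), p.2)
    fun_prop
  rw [LinearPMap.IsClosed, kappaNode_graph hS hκ]
  exact IsClosed.preimage h hc

/-- The passivity inequality with zero input. -/
theorem mainOp_dissipative (hS : IsImpedancePassive S) {x z : X}
    (h : (x, z) ∈ (mainOp S).graph) : (⟪z, x⟫_ℂ).re ≤ 0 := by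
  obtain ⟨y, hy⟩ := (mem_mainOp_graph_iff S _ _).1 h
  obtain ⟨hx, e⟩ := (mem_graph_iff_exists _ _ _).1 hy
  have e' : S ⟨(x, ((0 : U), (0 : Ud))), hx⟩ = (z, y) := e
  have := hS x 0 hx
  rw [e'] at this
  simpa using this

/-- The passivity inequality with the feedback input `-κ v`, whose contribution is `-κ ‖v‖² ≤ 0`. -/
theorem kappaGen_dissipative (hS : IsImpedancePassive S) (hκ : 0 ≤ κ) {x z : X}
    (h : (x, z) ∈ (kappaGen S κ).graph) : (⟪z, x⟫_ℂ).re ≤ 0 := by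
  obtain ⟨v, hx, e⟩ := (mem_kappaGen_graph_iff hS hκ x z).1 h
  have := hS x _ hx
  rw [e] at this
  refine this.trans ?_
  rw [inner_neg_right, inner_smul_right, inner_self_eq_norm_sq_to_K]
  simp only [Complex.coe_algebraMap, ← Complex.ofReal_pow, ← Complex.ofReal_mul, Complex.neg_re,
    Complex.ofReal_re]
  have : 0 ≤ κ * ‖v‖ ^ 2 := by positivity
  linarith

theorem transfer_apply (T : X × (U × Ud) →ₗ.[ℂ] X × U) (lam : ℂ) (u : U) (w : Ud) :
    transfer T lam (u, w) = transferC T lam u + transferD T lam w := by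
  simp [transferC, transferD, ← map_add]

theorem controlOp_apply (T : X × (U × Ud) →ₗ.[ℂ] X × U) (u : U) (w : Ud) :
    controlOp T (u, w) = controlC T u + controlD T w := by
  simp [controlC, controlD, ← map_add]

theorem extResolvent_kappaGen_controlOp (mu : ℂ) (u : U) (w : Ud) :
    extResolvent (kappaGen S κ) mu (controlOp (kappaNode S κ) (u, w)) =
      extResolvent (kappaGen S κ) mu (controlC (kappaNode S κ) u) +
      extResolvent (kappaGen S κ) mu (controlD (kappaNode S κ) w) := by
  change extResolvent (mainOp (kappaNode S κ)) mu (controlOp (kappaNode S κ) (u, w)) = _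
  rw [controlOp_apply, map_add]
  rfl

variable [CompleteSpace U]

theorem isUnit_one_add_smul_of_coercive {P : U →L[ℂ] U} {c : ℝ} (hc : 0 ≤ c)
    (hP : (reOp P - (c : ℂ) • ContinuousLinearMap.id ℂ U).IsPositive) (hκ : 0 ≤ κ) :
    IsUnit (1 + (κ : ℂ) • P) := by
  refine ContinuousLinearMap.isUnit_of_forall_le_norm_inner_map _ (c := 1) one_pos fun x => ?_
  have h1 : 0 ≤ (⟪P x, x⟫_ℂ).re := by
    have h := hP.re_inner_nonneg_left x
    simp only [reOp, sub_apply, smul_apply, add_apply, ContinuousLinearMap.id_apply,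
      inner_sub_left, inner_smul_left, inner_add_left, ContinuousLinearMap.adjoint_inner_left,
      inner_self_eq_norm_sq_to_K] at h
    have h2 : (⟪x, P x⟫_ℂ).re = (⟪P x, x⟫_ℂ).re := inner_re_symm (𝕜 := ℂ) _ _
    simp [← Complex.ofReal_pow, h2] at h
    nlinarith [mul_nonneg hc (sq_nonneg ‖x‖)]
  have h3 : (⟪(1 + (κ : ℂ) • P) x, x⟫_ℂ).re = ‖x‖ ^ 2 + κ * (⟪P x, x⟫_ℂ).re := by
    simp [inner_self_eq_norm_sq_to_K, ← Complex.ofReal_pow]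
  calc ‖x‖ ^ 2 * ((1 : NNReal) : ℝ) ≤ (⟪(1 + (κ : ℂ) • P) x, x⟫_ℂ).re := by
        rw [h3, NNReal.coe_one, mul_one]
        exact le_add_of_nonneg_right (mul_nonneg hκ h1)
    _ ≤ _ := Complex.re_le_norm _

variable [CompleteSpace X] [CompleteSpace Ud]

/-- At the point where `Re P_c` is coercive, `I + κ P_c` is invertible, so that the closed-loop
equation `lam x - z = A&B (x, u - κ y, w)`, `y = C&D (x, u - κ y, w)` is solvable for all data. -/
theorem exists_kappaNode_solution (hS : PassivityAssumption S) (hκ : 0 ≤ κ) :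
    ∃ lam : ℝ, 0 < lam ∧ ∀ (z : X) (u : U) (w : Ud), ∃ x y,
      ((x, (u, w)), ((lam : ℂ) • x - z, y)) ∈ (kappaNode S κ).graph := by
  obtain ⟨lam, c, hlam, hc, hres, hpos⟩ := hS.coercive
  refine ⟨lam, hlam, fun z u w => ?_⟩
  have hd := dense_domain_of_dissipative hlam (fun _ _ => mainOp_dissipative hS.passive) hres
  have hB : IsControlOp S (controlOp S) := by
    rw [controlOp, dif_pos hS.wellPosed.exists_controlOp]
    exact hS.wellPosed.exists_controlOp.choose_spec
  obtain ⟨y₀, hy₀⟩ := (mem_mainOp_graph_iff S _ _).1 (resolvent_mem_graph hres z)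
  obtain ⟨y, hy⟩ := (ContinuousLinearMap.isUnit_iff_bijective.1
    (isUnit_one_add_smul_of_coercive hc.le hpos hκ)).2 (y₀ + transfer S lam (u, w))
  have hy₁ := (mem_graph_iff_transfer hS.wellPosed.closed hd hB hres
    (u - (κ : ℂ) • y, w) _ _).2 ⟨rfl, rfl⟩
  have hsum := S.graph.add_mem hy₀ hy₁
  refine ⟨resolvent (mainOp S) lam z +
    extResolvent (mainOp S) lam (controlOp S (u - (κ : ℂ) • y, w)), y,
    (mem_kappaNode_graph_iff hS.passive hκ _ _ _ _ _).2 ?_⟩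
  have e : y₀ + transfer S lam (u - (κ : ℂ) • y, w) = y := by
    simp only [add_apply, one_apply_eq_self, smul_apply] at hy
    rw [transfer_apply] at hy ⊢
    rw [map_sub, map_smul, ← sub_eq_zero, ← sub_eq_zero.2 hy.symm]
    abel
  rw [smul_add, add_sub_right_comm]
  rwa [Prod.mk_add_mk, Prod.mk_add_mk, zero_add, Prod.mk_add_mk, e] at hsum

/-- For `mu ∈ ρ(A^κ)`, the equation `S (x, g, w) = (mu x, f)` determines `x` and `f` through the
closed-loop resolvent and transfer function, with closed-loop input `g + κ f`. -/
theorem mem_graph_iff_kappa (hS : PassivityAssumption S) (hκ : 0 ≤ κ) {mu : ℂ}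
    (hmu : mu ∈ resolventSet (kappaGen S κ)) (x : X) (g f : U) (w : Ud) :
    ((x, (g, w)), (mu • x, f)) ∈ S.graph ↔
      x = extResolvent (kappaGen S κ) mu (controlOp (kappaNode S κ) (g + (κ : ℂ) • f, w)) ∧
      f = transfer (kappaNode S κ) mu (g + (κ : ℂ) • f, w) := by
  -- The auxiliary point `lam > 0` yields density of `D(A^κ)` and solvability for every input,
  -- which make the chosen operators of the closed loop the genuine ones.
  obtain ⟨lam, hlam, hsol⟩ := exists_kappaNode_solution hS hκ
  have hdiss : ∀ x z, (x, z) ∈ (kappaGen S κ).graph → (⟪z, x⟫_ℂ).re ≤ 0 :=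
    fun _ _ => kappaGen_dissipative hS.passive hκ
  have hres : (lam : ℂ) ∈ resolventSet (kappaGen S κ) := by
    refine mem_resolventSet_of_dissipative hlam hdiss fun z => ?_
    obtain ⟨x, y, h⟩ := hsol z 0 0
    exact ⟨x, _, (mem_mainOp_graph_iff _ _ _).2 ⟨y, h⟩, sub_sub_cancel _ _⟩
  have hd := dense_domain_of_dissipative hlam hdiss hres
  have hc := isClosed_kappaNode hS.passive hκ hS.wellPosed.closed
  have hB := isControlOp_controlOp hc hd ⟨mu, hmu⟩ fun p => by
    obtain ⟨x, y, h⟩ := hsol 0 p.1 p.2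
    exact ⟨x, LinearPMap.mem_domain_of_mem_graph h⟩
  have key := mem_graph_iff_transfer hc hd hB hmu (g + (κ : ℂ) • f, w) x f
  rwa [mem_kappaNode_graph_iff hS.passive hκ, add_sub_cancel_right] at key

end ClosedLoop

/-! ### The regulator equations -/

section Regulator

/-- A skew-Hermitian matrix `M` has a basis of eigenvectors, since `i M` is Hermitian. -/
theorem exists_eigenbasis_of_skewHermitian {n : ℕ} {M : Matrix (Fin n) (Fin n) ℂ}
    (hM : M.conjTranspose = -M) :
    ∃ (b : Module.Basis (Fin n) ℂ (EuclideanSpace ℂ (Fin n))) (lam : Fin n → ℂ),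
      ∀ k, Matrix.toEuclideanLin M (b k) = lam k • b k := by
  have hH : (Complex.I • M).IsHermitian := by
    rw [Matrix.IsHermitian, Matrix.conjTranspose_smul, hM]
    simp
  refine ⟨hH.eigenvectorBasis.toBasis, fun k => -Complex.I * hH.eigenvalues k, fun k => ?_⟩
  rw [OrthonormalBasis.coe_toBasis]
  have h := congrArg (fun v => -Complex.I • v) (hH.mulVec_eigenvectorBasis k)
  simp only [Matrix.smul_mulVec, smul_smul] at h
  ext i
  have hi := congrFun h i
  simp at hi ⊢
  linear_combination hi

theorem mem_spectrum_of_eigenvector {n : ℕ} {M : Matrix (Fin n) (Fin n) ℂ}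
    {v : EuclideanSpace ℂ (Fin n)} {mu : ℂ} (hv : v ≠ 0)
    (h : Matrix.toEuclideanLin M v = mu • v) : mu ∈ spectrum ℂ M := by
  rw [← Matrix.spectrum_toLpLin 2]
  exact (Module.End.hasEigenvalue_of_hasEigenvector
    ⟨Module.End.mem_eigenspace_iff.2 h, hv⟩).mem_spectrum

theorem eq_ringInverse_iff {U : Type*} [NormedAddCommGroup U] [NormedSpace ℂ U] {P : U →L[ℂ] U}
    (hP : IsUnit P) (u v : U) : u = Ring.inverse P v ↔ P u = v := by
  constructor
  · rintro rfl
    rw [← mul_apply_eq_comp, Ring.mul_inverse_cancel _ hP, one_apply_eq_self]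
  · rintro rfl
    rw [← mul_apply_eq_comp, Ring.inverse_mul_cancel _ hP, one_apply_eq_self]

variable {X U Ud : Type*} [NormedAddCommGroup X] [InnerProductSpace ℂ X]
  [NormedAddCommGroup U] [InnerProductSpace ℂ U]
  [NormedAddCommGroup Ud] [InnerProductSpace ℂ Ud]
  {S : X × (U × Ud) →ₗ.[ℂ] X × U} {q : ℕ} {Aexo : Matrix (Fin q) (Fin q) ℂ}
  {E : EuclideanSpace ℂ (Fin q) →L[ℂ] Ud} {F : EuclideanSpace ℂ (Fin q) →L[ℂ] U}
  {Pi : EuclideanSpace ℂ (Fin q) →L[ℂ] X} {Gam : EuclideanSpace ℂ (Fin q) →L[ℂ] U}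
  {lam : Fin q → ℂ}

/-- By linearity the regulator equations need only be tested on a basis of eigenvectors. -/
theorem solvesRegulatorEquations_iff_basis
    (b : Module.Basis (Fin q) ℂ (EuclideanSpace ℂ (Fin q)))
    (hb : ∀ k, Matrix.toEuclideanLin Aexo (b k) = lam k • b k) :
    SolvesRegulatorEquations S Aexo E F Pi Gam ↔
      ∀ k, ((Pi (b k), (Gam (b k), E (b k))), (lam k • Pi (b k), F (b k))) ∈ S.graph := by
  let L : EuclideanSpace ℂ (Fin q) →ₗ[ℂ] (X × (U × Ud)) × (X × U) :=
    (Pi.toLinearMap.prod (Gam.toLinearMap.prod E.toLinearMap)).prod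
      ((Pi.toLinearMap ∘ₗ Matrix.toEuclideanLin Aexo).prod F.toLinearMap)
  have h1 : SolvesRegulatorEquations S Aexo E F Pi Gam ↔ ∀ v, L v ∈ S.graph := by
    refine forall_congr' fun v => ?_
    change _ ↔ ((Pi v, (Gam v, E v)), (Pi (Matrix.toEuclideanLin Aexo v), F v)) ∈ S.graph
    rw [mem_graph_iff_exists]
    simp only [eq_comm]
  have h2 : ∀ k, L (b k) = ((Pi (b k), (Gam (b k), E (b k))), (lam k • Pi (b k), F (b k))) := by
    intro k
    change ((Pi (b k), (Gam (b k), E (b k))),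
      (Pi (Matrix.toEuclideanLin Aexo (b k)), F (b k))) = _
    rw [hb, map_smul]
  simp_rw [h1, ← h2]
  refine ⟨fun h k => h _, fun h v => ?_⟩
  rw [← b.sum_repr v, map_sum]
  exact Submodule.sum_mem _ fun k _ => by
    rw [map_smul]
    exact S.graph.smul_mem _ (h k)

/-- On a basis of eigenvectors of `A_exo` the regulator equations decouple into the closed-loop
equations at the eigenvalues, and the invertibility of `P_c^κ` allows solving them for `Gam`. -/
theorem solvesRegulatorEquations_iff [CompleteSpace X] [CompleteSpace U] [CompleteSpace Ud]
    (hS : PassivityAssumption S) {κ : ℝ} (hκ : 0 ≤ κ)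
    (hspec : spectrum ℂ Aexo ∩ opSpectrum (kappaGen S κ) = ∅)
    (hinv : ∀ mu ∈ spectrum ℂ Aexo, IsUnit (transferC (kappaNode S κ) mu))
    (b : Module.Basis (Fin q) ℂ (EuclideanSpace ℂ (Fin q)))
    (hb : ∀ k, Matrix.toEuclideanLin Aexo (b k) = lam k • b k) :
    SolvesRegulatorEquations S Aexo E F Pi Gam ↔
      ∀ k,
        Pi (b k) =
          extResolvent (kappaGen S κ) (lam k)
            (controlC (kappaNode S κ) (Gam (b k) + (κ : ℂ) • F (b k))) +
          extResolvent (kappaGen S κ) (lam k) (controlD (kappaNode S κ) (E (b k))) ∧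
        Gam (b k) =
          Ring.inverse (transferC (kappaNode S κ) (lam k))
            (F (b k) - (κ : ℂ) • transferC (kappaNode S κ) (lam k) (F (b k))
              - transferD (kappaNode S κ) (lam k) (E (b k))) := by
  rw [solvesRegulatorEquations_iff_basis b hb]
  refine forall_congr' fun k => ?_
  have hs : lam k ∈ spectrum ℂ Aexo := mem_spectrum_of_eigenvector (b.ne_zero k) (hb k)
  have hres : lam k ∈ resolventSet (kappaGen S κ) := by
    by_contra h
    exact (Set.eq_empty_iff_forall_notMem.1 hspec) (lam k) ⟨hs, h⟩
  rw [mem_graph_iff_kappa hS hκ hres, extResolvent_kappaGen_controlOp, transfer_apply,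
    eq_ringInverse_iff (hinv _ hs), map_add (transferC _ _), map_smul (transferC _ _)]
  refine and_congr_right fun _ => ?_
  rw [eq_sub_iff_add_eq, eq_sub_iff_add_eq, eq_comm, add_right_comm]

end Regulator

end SysNode

end

theorem proposition3p6
    {X U Ud : Type*}
    [NormedAddCommGroup X] [InnerProductSpace ℂ X] [CompleteSpace X]
    [NormedAddCommGroup U] [InnerProductSpace ℂ U] [CompleteSpace U]
    [NormedAddCommGroup Ud] [InnerProductSpace ℂ Ud] [CompleteSpace Ud]
    (S : X × (U × Ud) →ₗ.[ℂ] X × U) (hS : SysNode.PassivityAssumption S)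
    (κ : ℝ) (hκ : 0 ≤ κ)
    (q : ℕ) (Aexo : Matrix (Fin q) (Fin q) ℂ) (hskew : Aexo.conjTranspose = -Aexo)
    (hspec : spectrum ℂ Aexo ∩ SysNode.opSpectrum (SysNode.kappaGen S κ) = ∅)
    (hinv : ∀ lam ∈ spectrum ℂ Aexo,
      IsUnit (SysNode.transferC (SysNode.kappaNode S κ) lam))
    (E : EuclideanSpace ℂ (Fin q) →L[ℂ] Ud) (F : EuclideanSpace ℂ (Fin q) →L[ℂ] U) :
    (∃! PG : (EuclideanSpace ℂ (Fin q) →L[ℂ] X) × (EuclideanSpace ℂ (Fin q) →L[ℂ] U),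
      SysNode.SolvesRegulatorEquations S Aexo E F PG.1 PG.2) ∧
    ∀ (φ : Fin q → EuclideanSpace ℂ (Fin q)) (lam : Fin q → ℂ),
      LinearIndependent ℂ φ →
      (∀ k, Matrix.toEuclideanLin Aexo (φ k) = lam k • φ k) →
      ∀ (Pi : EuclideanSpace ℂ (Fin q) →L[ℂ] X) (Gam : EuclideanSpace ℂ (Fin q) →L[ℂ] U),
        SysNode.SolvesRegulatorEquations S Aexo E F Pi Gam ↔
          ∀ k,
            Pi (φ k) =
              SysNode.extResolvent (SysNode.kappaGen S κ) (lam k)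
                (SysNode.controlC (SysNode.kappaNode S κ) (Gam (φ k) + (κ : ℂ) • F (φ k))) +
              SysNode.extResolvent (SysNode.kappaGen S κ) (lam k)
                (SysNode.controlD (SysNode.kappaNode S κ) (E (φ k))) ∧
            Gam (φ k) =
              Ring.inverse (SysNode.transferC (SysNode.kappaNode S κ) (lam k))
                (F (φ k)
                  - (κ : ℂ) • SysNode.transferC (SysNode.kappaNode S κ) (lam k) (F (φ k))
                  - SysNode.transferD (SysNode.kappaNode S κ) (lam k) (E (φ k))) := by
  refine ⟨?_, fun φ lam hφ hev Pi Gam => ?_⟩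
  · obtain ⟨b, lam, hb⟩ := SysNode.exists_eigenbasis_of_skewHermitian hskew
    let Gam : EuclideanSpace ℂ (Fin q) →L[ℂ] U :=
      LinearMap.toContinuousLinearMap (b.constr ℂ fun k =>
        Ring.inverse (SysNode.transferC (SysNode.kappaNode S κ) (lam k))
          (F (b k) - (κ : ℂ) • SysNode.transferC (SysNode.kappaNode S κ) (lam k) (F (b k))
            - SysNode.transferD (SysNode.kappaNode S κ) (lam k) (E (b k))))
    let Pi : EuclideanSpace ℂ (Fin q) →L[ℂ] X :=
      LinearMap.toContinuousLinearMap (b.constr ℂ fun k =>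
        SysNode.extResolvent (SysNode.kappaGen S κ) (lam k)
          (SysNode.controlC (SysNode.kappaNode S κ) (Gam (b k) + (κ : ℂ) • F (b k))) +
        SysNode.extResolvent (SysNode.kappaGen S κ) (lam k)
          (SysNode.controlD (SysNode.kappaNode S κ) (E (b k))))
    have hG : ∀ k, Gam (b k) = _ := b.constr_basis ℂ _
    have hP : ∀ k, Pi (b k) = _ := b.constr_basis ℂ _
    refine ⟨(Pi, Gam), (SysNode.solvesRegulatorEquations_iff hS hκ hspec hinv b hb).2
      fun k => ⟨hP k, hG k⟩, ?_⟩
    rintro ⟨Pi', Gam'⟩ hsol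
    have h := (SysNode.solvesRegulatorEquations_iff hS hκ hspec hinv b hb).1 hsol
    have hGam : Gam' = Gam :=
      ContinuousLinearMap.coe_injective (b.ext fun k => (h k).2.trans (hG k).symm)
    refine Prod.ext (ContinuousLinearMap.coe_injective (b.ext fun k => (h k).1.trans ?_)) hGam
    rw [hGam]
    exact (hP k).symm
  · let b := Module.Basis.mk hφ (hφ.span_eq_top_of_card_eq_finrank' (by simp)).ge
    have hbφ : ∀ k, b k = φ k := fun k => by simp [b]
    simpa only [hbφ] using SysNode.solvesRegulatorEquations_iff (E := E) (F := F) (Pi := Pi)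
      (Gam := Gam) hS hκ hspec hinv b (by simpa only [hbφ] using hev)
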